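/- Let $S\subset\mathbb{Z}$ be a finite set of steps, $A=S\cap\{0,1,2,\dots\}$ and $B=\{b>0 : -b\in S\}$, and suppose that $\alpha=\max A\ge 1$ and that $B$ is non-empty with $\beta=\max B$. Give every step $a\in A$ a weight $p_a$ and every step $-b$ with $b\in B$ a weight $q_b$ in a field $F$, with $p_\alpha\neq 0$ and $q_\beta\neq 0$. Let $w\ge 0$ and $0\le u,v\le w$. Let $\Omega_{(u,v),n}^{w,\alpha,\beta}$ be the set of directed $n$-step paths in the slit $\mathbb{Z}\times\{0,1,\dots,w\}$ from $(0,u)$ to $(n,v)$ with steps in $\{1\}\times S$, let the weight $\omega_\varphi$ of a path $\varphi$ be the product of the weights of its steps, and let $$G_{(u,v)}^{w,\alpha,\beta}(t)=\sum_{n\ge 0}t^n\sum_{\varphi\in\Omega_{(u,v),n}^{w,\alpha,\beta}}\omega_\varphi\in F[[t]].$$ Let $\bar z=(z_1,\dots,z_{\alpha+\beta})$ be the $\alpha+\beta$ roots, counted with multiplicity, in an extension field of $F((t))$ that contains all of them (for example an algebraic closure), of the kernel $$K(t,z)=1-t\sum_{a\in A}p_az^a-t\sum_{b\in B}q_bz^{-b},$$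 that is, of the polynomial $z^\beta K(t,z)$ in $z$. For partitions $\mu\subseteq\lambda$ let $s_{\lambda/\mu}(z_1,\dots,z_{\alpha+\beta})$ be the skew Schur function, the generating function of the semistandard tableaux of shape $\lambda/\mu$ with entries in $\{1,\dots,\alpha+\beta\}$, and let $s_\lambda=s_{\lambda/\emptyset}$; write $m^k$ for $k$ parts equal to $m$. Then $s_{((w+1)^\alpha,0^\beta)}(\bar z)\neq 0$ and $$G_{(u,v)}^{w,\alpha,\beta}(t)=\frac{(-1)^{1-\alpha}}{t\,p_\alpha}\;\frac{s_{(w^\alpha,u,0^{\beta-1})/(v,0^{\alpha+\beta-1})}(\bar z)}{s_{((w+1)^\alpha,0^\beta)}(\bar z)}.$$ -/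

import Mathlib

namespace SlitPaths

/-! ### Step sets, directed paths in a slit and their generating function -/

/-- The heights `a ≥ 0` of the up steps (and of the horizontal step) of `S`:
`A = S ∩ {0, 1, 2, …}`. -/
def upSteps (S : Finset ℤ) : Finset ℕ :=
  (S.filter (fun s => 0 ≤ s)).image Int.toNat

/-- The heights `b > 0` of the down steps of `S`: `B = -(S \ A)`. -/
def downSteps (S : Finset ℤ) : Finset ℕ :=
  (S.filter (fun s => s < 0)).image (fun s => (-s).toNat)

/-- The weight of a step: `p a` for the step `a ≥ 0`, and `q b` for the step `-b < 0`. -/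
def stepWeight {F : Type*} (p q : ℕ → F) (s : ℤ) : F :=
  if 0 ≤ s then p s.toNat else q (-s).toNat

/-- The `i`-th step of the path that visits `(0, h 0), (1, h 1), …, (n, h n)`. -/
def stepOf {w n : ℕ} (h : Fin (n + 1) → Fin (w + 1)) (i : Fin n) : ℤ :=
  ((h i.succ : ℕ) : ℤ) - ((h i.castSucc : ℕ) : ℤ)

/-- The directed `n`-step paths in the slit `ℤ × {0, …, w}` from `(0, u)` to `(n, v)` with steps
in `{1} × S`; such a path is given by its sequence of heights. -/
def paths (S : Finset ℤ) (w : ℕ) (u v : Fin (w + 1)) (n : ℕ) :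
    Finset (Fin (n + 1) → Fin (w + 1)) :=
  Finset.univ.filter (fun h => h 0 = u ∧ h (Fin.last n) = v ∧ ∀ i, stepOf h i ∈ S)

/-- The weight of a path: the product of the weights of its steps. -/
def pathWeight {F : Type*} [CommMonoid F] (p q : ℕ → F) {w n : ℕ}
    (h : Fin (n + 1) → Fin (w + 1)) : F :=
  ∏ i, stepWeight p q (stepOf h i)

/-- The generating function, a formal power series in `t`, of the weighted directed paths
from height `u` to height `v` in the slit of width `w`. -/
noncomputable def pathGenFun {F : Type*} [Field F] (S : Finset ℤ) (p q : ℕ → F) (w : ℕ)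
    (u v : Fin (w + 1)) : PowerSeries F :=
  PowerSeries.mk (fun n => ∑ h ∈ paths S w u v n, pathWeight p q h)

/-! ### The kernel -/

/-- The variable `t`, as an element of the field `F((t))`. -/
noncomputable def tVar (F : Type*) [Field F] : LaurentSeries F :=
  ((PowerSeries.X : PowerSeries F) : LaurentSeries F)

/-- The kernel `K(t,z) = 1 - t ∑_{a ∈ A} p_a z^a - t ∑_{b ∈ B} q_b z^{-b}`, a Laurent polynomial
in `z` over `F((t))`. -/
noncomputable def kernel {F : Type*} [Field F] (S : Finset ℤ) (p q : ℕ → F) :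
    LaurentPolynomial (LaurentSeries F) :=
  1 - LaurentPolynomial.C (tVar F) * ∑ a ∈ upSteps S,
        LaurentPolynomial.C (HahnSeries.C (p a)) * LaurentPolynomial.T (a : ℤ)
    - LaurentPolynomial.C (tVar F) * ∑ b ∈ downSteps S,
        LaurentPolynomial.C (HahnSeries.C (q b)) * LaurentPolynomial.T (-(b : ℤ))

/-- The polynomial `z^β K(t,z)`, where `β` is the maximum of `B`.
Its roots, with multiplicities, are the roots of the kernel. -/
noncomputable def kernelPoly {F : Type*} [Field F] (S : Finset ℤ) (p q : ℕ → F) (β : ℕ) :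
    Polynomial (LaurentSeries F) :=
  Polynomial.X ^ β
    - Polynomial.C (tVar F) * ∑ a ∈ upSteps S,
        Polynomial.C (HahnSeries.C (p a)) * Polynomial.X ^ (a + β)
    - Polynomial.C (tVar F) * ∑ b ∈ downSteps S,
        Polynomial.C (HahnSeries.C (q b)) * Polynomial.X ^ (β - b)

theorem toLaurent_kernelPoly {F : Type*} [Field F] (S : Finset ℤ) (p q : ℕ → F) (β : ℕ)
    (hβ : ∀ b ∈ downSteps S, b ≤ β) :
    Polynomial.toLaurent (kernelPoly S p q β)
      = LaurentPolynomial.T (β : ℤ) * kernel S p q := by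
  have hb : ∀ b ∈ downSteps S,
      LaurentPolynomial.C (HahnSeries.C (q b)) *
        (LaurentPolynomial.T ((β - b : ℕ) : ℤ) : LaurentPolynomial (LaurentSeries F))
      = LaurentPolynomial.T (β : ℤ) *
        (LaurentPolynomial.C (HahnSeries.C (q b)) * LaurentPolynomial.T (-(b : ℤ))) := by
    intro b h
    rw [Nat.cast_sub (hβ b h), sub_eq_add_neg, LaurentPolynomial.T_add]
    ring
  have ha : ∀ a ∈ upSteps S,
      LaurentPolynomial.C (HahnSeries.C (p a)) *
        (LaurentPolynomial.T ((a + β : ℕ) : ℤ) : LaurentPolynomial (LaurentSeries F))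
      = LaurentPolynomial.T (β : ℤ) *
        (LaurentPolynomial.C (HahnSeries.C (p a)) * LaurentPolynomial.T (a : ℤ)) := by
    intro a _
    rw [Nat.cast_add, LaurentPolynomial.T_add]
    ring
  simp only [kernelPoly, kernel, map_sub, map_mul, map_sum, Polynomial.toLaurent_C,
    Polynomial.toLaurent_X_pow]
  rw [Finset.sum_congr rfl ha, Finset.sum_congr rfl hb, ← Finset.mul_sum, ← Finset.mul_sum]
  ring

/-! ### Schur and skew Schur functions -/

/-- A filling `T` of a set `D` of cells (row, column) is semistandard if its entries weakly
increase along each row and strictly increase down each column. -/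
def IsSemistandard {n : ℕ} {D : Finset (ℕ × ℕ)} (T : {c // c ∈ D} → Fin n) : Prop :=
  (∀ c d : {c // c ∈ D}, c.1.1 = d.1.1 → c.1.2 ≤ d.1.2 → T c ≤ T d) ∧
  (∀ c d : {c // c ∈ D}, c.1.2 = d.1.2 → c.1.1 < d.1.1 → T c < T d)

open Classical in
/-- The skew Schur function `s_{lam/mu}` in `n` variables: the sum over all semistandard tableaux
of shape `lam/mu` with entries in `{1, …, n}` of the product of the variables indexed by the
entries; it is zero unless `mu ⊆ lam`. -/
noncomputable def skewSchur (n : ℕ) (lam mu : YoungDiagram) : MvPolynomial (Fin n) ℤ :=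
  if mu ≤ lam then
    ∑ T : {c // c ∈ lam.cells \ mu.cells} → Fin n with IsSemistandard T,
      ∏ c, MvPolynomial.X (T c)
  else 0

/-- The Schur function `s_lam` in `n` variables. -/
noncomputable def schur (n : ℕ) (lam : YoungDiagram) : MvPolynomial (Fin n) ℤ :=
  skewSchur n lam ⊥

/-! ### The three partitions -/

theorem sortedGE_outer (α β w u : ℕ) (hu : u ≤ w) :
    (List.replicate α w ++ u :: List.replicate (β - 1) 0).SortedGE := by
  rw [List.sortedGE_iff_pairwise, List.pairwise_append]
  refine ⟨List.pairwise_replicate.2 (Or.inr le_rfl), List.pairwise_cons.2 ⟨?_,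
    List.pairwise_replicate.2 (Or.inr le_rfl)⟩, ?_⟩
  · intro b hb
    rw [List.eq_of_mem_replicate hb]
    exact Nat.zero_le u
  · intro a ha b hb
    rw [List.eq_of_mem_replicate ha]
    rcases List.mem_cons.1 hb with rfl | hb
    · exact hu
    · rw [List.eq_of_mem_replicate hb]
      exact Nat.zero_le w

theorem sortedGE_cons_zeros (m v : ℕ) : (v :: List.replicate m 0).SortedGE := by
  simpa using sortedGE_outer 0 (m + 1) v v le_rfl

theorem sortedGE_rect (α β w : ℕ) :
    (List.replicate α w ++ List.replicate β 0).SortedGE := by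
  rw [List.sortedGE_iff_pairwise, List.pairwise_append]
  refine ⟨List.pairwise_replicate.2 (Or.inr le_rfl), List.pairwise_replicate.2 (Or.inr le_rfl), ?_⟩
  intro a _ b hb
  rw [List.eq_of_mem_replicate hb]
  exact Nat.zero_le a

/-- The partition `(w^α, u, 0^{β-1})`, for `u ≤ w`. -/
def outerShape (α β w : ℕ) (u : Fin (w + 1)) : YoungDiagram :=
  YoungDiagram.ofRowLens (List.replicate α w ++ (u : ℕ) :: List.replicate (β - 1) 0)
    (sortedGE_outer α β w u (Nat.le_of_lt_succ u.isLt))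

/-- The partition `(v, 0^{α+β-1})`. -/
def innerShape (α β v : ℕ) : YoungDiagram :=
  YoungDiagram.ofRowLens (v :: List.replicate (α + β - 1) 0) (sortedGE_cons_zeros _ v)

/-- The partition `(m^α, 0^β)`. -/
def rectShape (α β m : ℕ) : YoungDiagram :=
  YoungDiagram.ofRowLens (List.replicate α m ++ List.replicate β 0) (sortedGE_rect α β m)

end SlitPaths

/-! Let `T` be the transfer matrix of the slit, whose entry at `(i, j)` is the weight of the step `j
- i`. Splitting off the first step of a path gives `(1 - tT) G = 1`, so `G` at `(u, v)` is the
corresponding entry of the adjugate of `1 - tT` divided by the determinant.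

The entry of `1 - tT` at `(i, j)` depends only on `j - i` and is a coefficient of the kernel. By
Vieta it equals `κ (-1)^(i+j) e_{α+i-j}(z)` with `κ = -t p_α (-1)^α` (`map_kernelMatrix_apply`). The
checkerboard signs cancel in the determinant and against the cofactor sign, so `G` at `(u, v)` is
`κ⁻¹` times a minor of the Toeplitz matrix `(e_{α+i-j})` over its determinant.

The dual Jacobi–Trudi identity `det_jacobiTrudi` identifies both: the full determinant is the Schur
function of a rectangle, and the minor without row `v` and column `u` is the skew Schur function.
The rectangular Schur function is nonzero because `1 - tT` is invertible.

The dual Jacobi–Trudi identity is proved by induction on the number of variables. On tableaux, the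
cells with the largest entry are removed, at most one from the bottom of each column. On
determinants, the recursion for `e_k` splits every row in two. Both sides become sums over sets of
shortened columns, and the determinants that correspond to no shape vanish. -/

namespace SlitPaths

open Finset

/-! ### Removing the largest entry from semistandard tableaux -/

open Classical in
/-- The generating function, evaluated at `x`, of the semistandard fillings of a set of cells. -/
noncomputable def tableauSum {R : Type*} [CommRing R] {n : ℕ} (x : Fin n → R)
    (D : Finset (ℕ × ℕ)) : R :=
  ∑ T : {c // c ∈ D} → Fin n with IsSemistandard T, ∏ c, x (T c)

/-- The sets of cells of `D` that can carry the largest entry of a semistandard filling of `D`. -/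
def IsTerminal (D E : Finset (ℕ × ℕ)) : Prop :=
  E ⊆ D ∧ (∀ c ∈ E, ∀ d ∈ D, c.1 = d.1 → c.2 ≤ d.2 → d ∈ E) ∧
    ∀ c ∈ E, ∀ d ∈ D, c.2 = d.2 → ¬ c.1 < d.1

/-- The cells of `D` that carry the largest entry. -/
def lastCells {n : ℕ} {D : Finset (ℕ × ℕ)} (T : {c // c ∈ D} → Fin (n + 1)) :
    Finset (ℕ × ℕ) :=
  (univ.filter fun c => T c = Fin.last n).map (Function.Embedding.subtype _)

theorem mem_lastCells {n : ℕ} {D : Finset (ℕ × ℕ)} (T : {c // c ∈ D} → Fin (n + 1))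
    (c : ℕ × ℕ) : c ∈ lastCells T ↔ ∃ h : c ∈ D, T ⟨c, h⟩ = Fin.last n := by
  simp [lastCells]

theorem isTerminal_lastCells {n : ℕ} {D : Finset (ℕ × ℕ)} {T : {c // c ∈ D} → Fin (n + 1)}
    (hT : IsSemistandard T) : IsTerminal D (lastCells T) := by
  refine ⟨fun c hc => ((mem_lastCells T c).1 hc).1, fun c hc d hd h1 h2 => ?_,
    fun c hc d hd h1 h2 => ?_⟩
  · obtain ⟨hcD, hc⟩ := (mem_lastCells T c).1 hc
    refine (mem_lastCells T d).2 ⟨hd, ?_⟩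
    have := hT.1 ⟨c, hcD⟩ ⟨d, hd⟩ h1 h2
    rw [hc] at this
    exact Fin.last_le_iff.1 this
  · obtain ⟨hcD, hc⟩ := (mem_lastCells T c).1 hc
    have := hT.2 ⟨c, hcD⟩ ⟨d, hd⟩ h1 h2
    rw [hc] at this
    exact absurd this (Fin.le_last _).not_gt

/-- Extend a filling of `D \ E` by the largest entry on `E`. -/
def extendLast {n : ℕ} (D E : Finset (ℕ × ℕ)) (T : {c // c ∈ D \ E} → Fin n)
    (c : {c // c ∈ D}) : Fin (n + 1) :=
  if h : c.1 ∈ E then Fin.last n else (T ⟨c.1, mem_sdiff.2 ⟨c.2, h⟩⟩).castSucc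

theorem extendLast_of_mem {n : ℕ} {D E : Finset (ℕ × ℕ)} (T : {c // c ∈ D \ E} → Fin n)
    {c : {c // c ∈ D}} (h : c.1 ∈ E) : extendLast D E T c = Fin.last n := dif_pos h

theorem extendLast_of_notMem {n : ℕ} {D E : Finset (ℕ × ℕ)} (T : {c // c ∈ D \ E} → Fin n)
    {c : {c // c ∈ D}} (h : c.1 ∉ E) :
    extendLast D E T c = (T ⟨c.1, mem_sdiff.2 ⟨c.2, h⟩⟩).castSucc := dif_neg h

theorem lastCells_extendLast {n : ℕ} {D E : Finset (ℕ × ℕ)} (hE : E ⊆ D)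
    (T : {c // c ∈ D \ E} → Fin n) : lastCells (extendLast D E T) = E := by
  ext c
  rw [mem_lastCells]
  constructor
  · rintro ⟨h, hc⟩
    by_contra hn
    rw [extendLast_of_notMem T (c := ⟨c, h⟩) hn] at hc
    exact (Fin.castSucc_lt_last _).ne hc
  · exact fun h => ⟨hE h, extendLast_of_mem T h⟩

/-- Terminality makes every comparison that involves a cell of `E` automatic: what lies to the right
of `E` is in `E`, and nothing lies below it. -/
theorem isSemistandard_extendLast {n : ℕ} {D E : Finset (ℕ × ℕ)} (hE : IsTerminal D E)
    (T : {c // c ∈ D \ E} → Fin n) : IsSemistandard (extendLast D E T) ↔ IsSemistandard T := by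
  constructor
  · intro h
    have key : ∀ c : {c // c ∈ D \ E}, extendLast D E T ⟨c.1, (mem_sdiff.1 c.2).1⟩
        = (T c).castSucc := fun c => extendLast_of_notMem T (mem_sdiff.1 c.2).2
    refine ⟨fun c d h1 h2 => ?_, fun c d h1 h2 => ?_⟩
    · have := h.1 ⟨c.1, (mem_sdiff.1 c.2).1⟩ ⟨d.1, (mem_sdiff.1 d.2).1⟩ h1 h2
      rwa [key, key, Fin.castSucc_le_castSucc_iff] at this
    · have := h.2 ⟨c.1, (mem_sdiff.1 c.2).1⟩ ⟨d.1, (mem_sdiff.1 d.2).1⟩ h1 h2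
      rwa [key, key, Fin.castSucc_lt_castSucc_iff] at this
  · intro h
    refine ⟨fun c d h1 h2 => ?_, fun c d h1 h2 => ?_⟩
    · by_cases hd : d.1 ∈ E
      · rw [extendLast_of_mem T hd]
        exact Fin.le_last _
      · have hc : c.1 ∉ E := fun hc => hd (hE.2.1 c.1 hc d.1 d.2 h1 h2)
        rw [extendLast_of_notMem T hd, extendLast_of_notMem T hc, Fin.castSucc_le_castSucc_iff]
        exact h.1 _ _ h1 h2
    · have hc : c.1 ∉ E := fun hc => hE.2.2 c.1 hc d.1 d.2 h1 h2
      rw [extendLast_of_notMem T hc]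
      by_cases hd : d.1 ∈ E
      · rw [extendLast_of_mem T hd]
        exact Fin.castSucc_lt_last _
      · rw [extendLast_of_notMem T hd, Fin.castSucc_lt_castSucc_iff]
        exact h.2 _ _ h1 h2

theorem extendLast_injective {n : ℕ} {D E : Finset (ℕ × ℕ)} :
    Function.Injective (extendLast (n := n) D E) := by
  intro T T' h
  ext c : 1
  have := congrFun h ⟨c.1, (mem_sdiff.1 c.2).1⟩
  rw [extendLast_of_notMem T (mem_sdiff.1 c.2).2,
    extendLast_of_notMem T' (mem_sdiff.1 c.2).2] at this
  exact Fin.castSucc_injective _ this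

theorem exists_extendLast_eq {n : ℕ} {D : Finset (ℕ × ℕ)} (T : {c // c ∈ D} → Fin (n + 1)) :
    ∃ T', extendLast D (lastCells T) T' = T := by
  have hne : ∀ c : {c // c ∈ D \ lastCells T}, T ⟨c.1, (mem_sdiff.1 c.2).1⟩ ≠ Fin.last n :=
    fun c h => (mem_sdiff.1 c.2).2 ((mem_lastCells T _).2 ⟨_, h⟩)
  refine ⟨fun c => (T ⟨c.1, (mem_sdiff.1 c.2).1⟩).castPred (hne c), ?_⟩
  ext c : 1
  by_cases hc : c.1 ∈ lastCells T
  · rw [extendLast_of_mem _ hc]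
    exact ((mem_lastCells T _).1 hc).2.symm
  · rw [extendLast_of_notMem _ hc, Fin.castSucc_castPred]

theorem prod_extendLast {R : Type*} [CommRing R] {n : ℕ} {D E : Finset (ℕ × ℕ)} (hE : E ⊆ D)
    (x : Fin (n + 1) → R) (T : {c // c ∈ D \ E} → Fin n) :
    ∏ c, x (extendLast D E T c) = x (Fin.last n) ^ #E * ∏ c, x (T c).castSucc := by
  -- A function on all cells turns the products over subtypes into products over finsets; its
  -- default value is the one required on `E`.
  let g : ℕ × ℕ → R := fun c => if h : c ∈ D \ E then x (T ⟨c, h⟩).castSucc else x (Fin.last n)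
  have h1 : ∏ c, x (extendLast D E T c) = ∏ c ∈ D, g c := by
    rw [← Finset.prod_coe_sort D g]
    refine Finset.prod_congr rfl fun c _ => ?_
    by_cases hc : c.1 ∈ E
    · rw [extendLast_of_mem T hc]
      simp [g, hc]
    · rw [extendLast_of_notMem T hc]
      simp [g, hc]
  have h2 : ∏ c, x (T c).castSucc = ∏ c ∈ D \ E, g c := by
    rw [← Finset.prod_coe_sort (D \ E) g]
    refine Finset.prod_congr rfl fun c _ => ?_
    simp only [g, c.2, dif_pos]
  have h3 : ∏ c ∈ E, g c = x (Fin.last n) ^ #E := by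
    refine Finset.prod_eq_pow_card fun c hc => ?_
    simp [g, hc]
  rw [h1, h2, ← h3, ← Finset.prod_sdiff hE, mul_comm]

-- Tableaux are grouped by the set of cells with the largest entry; deleting these cells is a
-- bijection onto the tableaux of the remaining shape with one entry fewer.
open Classical in
theorem tableauSum_succ {R : Type*} [CommRing R] {n : ℕ} (x : Fin (n + 1) → R)
    (D : Finset (ℕ × ℕ)) :
    tableauSum x D = ∑ E ∈ D.powerset with IsTerminal D E,
      x (Fin.last n) ^ #E * tableauSum (fun i => x i.castSucc) (D \ E) := by
  unfold tableauSum
  rw [← Finset.sum_fiberwise_of_maps_to (g := lastCells)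
    (t := D.powerset.filter fun E => IsTerminal D E)]
  · refine Finset.sum_congr rfl fun E hE => ?_
    have hE := (mem_filter.1 hE).2
    rw [Finset.mul_sum]
    symm
    refine Finset.sum_bij (fun T _ => extendLast D E T) ?_ ?_ ?_ ?_
    · intro T hT
      simp only [mem_filter, mem_univ, true_and] at hT ⊢
      exact ⟨(isSemistandard_extendLast hE T).2 hT, lastCells_extendLast hE.1 T⟩
    · intro T _ T' _ h
      exact extendLast_injective h
    · intro T hT
      simp only [mem_filter, mem_univ, true_and] at hT
      obtain ⟨hT, rfl⟩ := hT
      obtain ⟨T', hT'⟩ := exists_extendLast_eq T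
      refine ⟨T', ?_, hT'⟩
      simp only [mem_filter, mem_univ, true_and]
      rw [← isSemistandard_extendLast hE, hT']
      exact hT
    · intro T _
      exact (prod_extendLast hE.1 x T).symm
  · intro T hT
    have := isTerminal_lastCells (mem_filter.1 hT).2
    exact mem_filter.2 ⟨mem_powerset.2 this.1, this⟩

open Classical in
theorem tableauSum_zero {R : Type*} [CommRing R] (x : Fin 0 → R) (D : Finset (ℕ × ℕ)) :
    tableauSum x D = if D = ∅ then 1 else 0 := by
  unfold tableauSum
  split_ifs with h
  · subst h
    have : (univ.filter fun T : {c // c ∈ (∅ : Finset (ℕ × ℕ))} → Fin 0 => IsSemistandard T)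
        = univ := by
      refine filter_true_of_mem fun T _ => ⟨fun c => ?_, fun c => ?_⟩ <;>
        exact absurd c.2 (notMem_empty _)
    rw [this]
    simp
  · obtain ⟨c, hc⟩ := nonempty_iff_ne_empty.2 h
    refine Finset.sum_eq_zero fun T _ => (T ⟨c, hc⟩).elim0

/-! ### Elementary symmetric polynomials -/

/-- The `k`-th elementary symmetric polynomial, evaluated at `x`, for an integer `k`. -/
def esymmInt {R : Type*} [CommRing R] : {n : ℕ} → (Fin n → R) → ℤ → R
  | 0, _, k => if k = 0 then 1 else 0
  | n + 1, x, k => esymmInt (fun i : Fin n => x i.castSucc) k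
      + x (Fin.last n) * esymmInt (fun i : Fin n => x i.castSucc) (k - 1)

theorem esymmInt_eq_zero_of_lt {R : Type*} [CommRing R] {n : ℕ} (x : Fin n → R) {k : ℤ}
    (hk : (n : ℤ) < k) : esymmInt x k = 0 := by
  induction n generalizing k with
  | zero => simp only [esymmInt]; exact if_neg (by omega)
  | succ n ih =>
    push_cast at hk
    simp only [esymmInt]
    rw [ih _ (by omega), ih _ (by omega), mul_zero, add_zero]

theorem esymmInt_eq_zero_of_neg {R : Type*} [CommRing R] {n : ℕ} (x : Fin n → R) {k : ℤ}
    (hk : k < 0) : esymmInt x k = 0 := by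
  induction n generalizing k with
  | zero => simp only [esymmInt]; exact if_neg (by omega)
  | succ n ih =>
    simp only [esymmInt]
    rw [ih _ hk, ih _ (by omega), mul_zero, add_zero]

/-- Vieta's formula: multiplying by one more linear factor is the recursion that defines `esymmInt`.
-/
theorem coeff_prod_X_sub_C {R : Type*} [CommRing R] {n : ℕ} (x : Fin n → R) (k : ℕ) :
    (∏ i, (Polynomial.X - Polynomial.C (x i))).coeff k
      = (-1) ^ (n + k) * esymmInt x ((n : ℤ) - k) := by
  induction n generalizing k with
  | zero =>
    rcases k with _ | k
    · simp [esymmInt]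
    · have : (((0 : ℕ) : ℤ) - ((k + 1 : ℕ) : ℤ)) < 0 := by push_cast; omega
      rw [esymmInt_eq_zero_of_neg _ this]
      simp [Polynomial.coeff_one]
  | succ n ih =>
    rw [Fin.prod_univ_castSucc]
    simp only [esymmInt]
    rcases k with _ | k
    · rw [Polynomial.mul_coeff_zero, ih]
      have h0 : esymmInt (fun i : Fin n => x i.castSucc) (((n + 1 : ℕ) : ℤ) - ((0 : ℕ) : ℤ)) = 0 :=
        esymmInt_eq_zero_of_lt _ (by push_cast; omega)
      have h1 : ((n + 1 : ℕ) : ℤ) - ((0 : ℕ) : ℤ) - 1 = (n : ℤ) - ((0 : ℕ) : ℤ) := by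
        push_cast; ring
      rw [h0, h1]
      simp only [Polynomial.coeff_sub, Polynomial.coeff_X_zero, Polynomial.coeff_C_zero]
      ring
    · rw [mul_sub, Polynomial.coeff_sub, Polynomial.coeff_mul_X, Polynomial.coeff_mul_C, ih, ih]
      have h0 : ((n + 1 : ℕ) : ℤ) - ((k + 1 : ℕ) : ℤ) = (n : ℤ) - (k : ℤ) := by push_cast; ring
      have h1 : (n : ℤ) - (k : ℤ) - 1 = (n : ℤ) - ((k + 1 : ℕ) : ℤ) := by push_cast; ring
      rw [h0, h1]
      ring

/-! ### Skew shapes given by column heights -/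

/-- The cells of the skew shape whose `j`-th column consists of the rows `d j, …, c j - 1`. -/
def columnCells {m : ℕ} (c : Fin m → ℤ) (d : Fin m → ℕ) : Finset (ℕ × ℕ) :=
  univ.biUnion fun j : Fin m => (range (c j).toNat \ range (d j)) ×ˢ {(j : ℕ)}

theorem mem_columnCells {m : ℕ} {c : Fin m → ℤ} {d : Fin m → ℕ} {i : ℕ} {j : ℕ} :
    (i, j) ∈ columnCells c d ↔ ∃ h : j < m, d ⟨j, h⟩ ≤ i ∧ (i : ℤ) < c ⟨j, h⟩ := by
  simp only [columnCells, mem_biUnion, mem_univ, true_and, mem_product, mem_sdiff, mem_range,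
    mem_singleton, not_lt]
  constructor
  · rintro ⟨j', ⟨h1, h2⟩, rfl⟩
    exact ⟨j'.2, h2, Int.lt_toNat.1 h1⟩
  · rintro ⟨h, h1, h2⟩
    exact ⟨⟨j, h⟩, ⟨Int.lt_toNat.2 h2, h1⟩, rfl⟩

theorem mem_columnCells_val {m : ℕ} {c : Fin m → ℤ} {d : Fin m → ℕ} {i : ℕ} {j : Fin m} :
    (i, (j : ℕ)) ∈ columnCells c d ↔ d j ≤ i ∧ (i : ℤ) < c j := by
  rw [mem_columnCells]
  exact ⟨fun h => h.2, fun h => ⟨j.2, h⟩⟩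

/-- Remove one cell from the bottom of each of the columns in `s`. -/
def shorten {m : ℕ} (c : Fin m → ℤ) (s : Finset (Fin m)) (j : Fin m) : ℤ :=
  c j - if j ∈ s then 1 else 0

theorem shorten_of_mem {m : ℕ} (c : Fin m → ℤ) {s : Finset (Fin m)} {j : Fin m} (h : j ∈ s) :
    shorten c s j = c j - 1 := by simp [shorten, h]

theorem shorten_of_notMem {m : ℕ} (c : Fin m → ℤ) {s : Finset (Fin m)} {j : Fin m}
    (h : j ∉ s) : shorten c s j = c j := by simp [shorten, h]

theorem shorten_le {m : ℕ} (c : Fin m → ℤ) (s : Finset (Fin m)) (j : Fin m) :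
    shorten c s j ≤ c j := by
  unfold shorten; split_ifs <;> omega

theorem sub_one_le_shorten {m : ℕ} (c : Fin m → ℤ) (s : Finset (Fin m)) (j : Fin m) :
    c j - 1 ≤ shorten c s j := by
  unfold shorten; split_ifs <;> omega

/-- The bottom cells of the columns in `s`. -/
def bottomCells {m : ℕ} (c : Fin m → ℤ) (s : Finset (Fin m)) : Finset (ℕ × ℕ) :=
  s.image fun j => ((c j - 1).toNat, (j : ℕ))

theorem card_bottomCells {m : ℕ} (c : Fin m → ℤ) (s : Finset (Fin m)) :
    #(bottomCells c s) = #s :=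
  card_image_of_injective _ fun _ _ h => Fin.ext (Prod.mk.inj h).2

/-- Positivity matters because `toNat` would give an empty column a false bottom cell in row `0`. -/
theorem mem_bottomCells {m : ℕ} {c : Fin m → ℤ} {s : Finset (Fin m)} {i : ℕ} {j : Fin m}
    (hj : j ∈ s → 0 < c j) : (i, (j : ℕ)) ∈ bottomCells c s ↔ j ∈ s ∧ (i : ℤ) = c j - 1 := by
  simp only [bottomCells, mem_image, Prod.mk.injEq]
  constructor
  · rintro ⟨j', hj', h1, h2⟩
    obtain rfl := Fin.ext h2
    have := hj hj'
    exact ⟨hj', by omega⟩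
  · rintro ⟨h, h1⟩
    exact ⟨j, h, by omega, rfl⟩

theorem exists_column_of_mem {m : ℕ} {c : Fin m → ℤ} {d : Fin m → ℕ} {a : ℕ × ℕ}
    (h : a ∈ columnCells c d) :
    ∃ (i : ℕ) (j : Fin m), a = (i, (j : ℕ)) ∧ d j ≤ i ∧ (i : ℤ) < c j := by
  obtain ⟨i, j⟩ := a
  obtain ⟨hj, h1, h2⟩ := mem_columnCells.1 h
  exact ⟨i, ⟨j, hj⟩, rfl, h1, h2⟩

theorem pos_of_le_shorten {m : ℕ} {c : Fin m → ℤ} {d : Fin m → ℕ} {s : Finset (Fin m)}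
    (hs : ∀ j, (d j : ℤ) ≤ shorten c s j) (j : Fin m) (hj : j ∈ s) : 0 < c j := by
  have := hs j
  rw [shorten_of_mem c hj] at this
  omega

theorem columnCells_sdiff_bottomCells {m : ℕ} {c : Fin m → ℤ} {d : Fin m → ℕ}
    {s : Finset (Fin m)} (hs : ∀ j, (d j : ℤ) ≤ shorten c s j) :
    columnCells c d \ bottomCells c s = columnCells (shorten c s) d := by
  ext a
  rw [mem_sdiff]
  constructor
  · rintro ⟨h1, h2⟩
    obtain ⟨i, j, rfl, h3, h4⟩ := exists_column_of_mem h1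
    rw [mem_bottomCells (pos_of_le_shorten hs j)] at h2
    rw [mem_columnCells_val]
    by_cases hj : j ∈ s
    · rw [shorten_of_mem c hj]
      have : (i : ℤ) ≠ c j - 1 := fun h => h2 ⟨hj, h⟩
      omega
    · rw [shorten_of_notMem c hj]
      omega
  · intro h
    obtain ⟨i, j, rfl, h3, h4⟩ := exists_column_of_mem h
    rw [mem_bottomCells (pos_of_le_shorten hs j), mem_columnCells_val]
    have := shorten_le c s j
    refine ⟨by omega, fun ⟨hj, h⟩ => ?_⟩
    rw [shorten_of_mem c hj] at h4
    omega

theorem isTerminal_bottomCells {m : ℕ} {c : Fin m → ℤ} {d : Fin m → ℕ}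
    (hc : Antitone c) {s : Finset (Fin m)}
    (hs : ∀ j, (d j : ℤ) ≤ shorten c s j) (ha : Antitone (shorten c s)) :
    IsTerminal (columnCells c d) (bottomCells c s) := by
  have hsub : bottomCells c s ⊆ columnCells c d := by
    intro a h
    obtain ⟨j, hj, rfl⟩ := mem_image.1 h
    rw [mem_columnCells_val]
    have h1 := pos_of_le_shorten hs j hj
    have h2 := hs j
    rw [shorten_of_mem c hj] at h2
    omega
  refine ⟨hsub, fun a h b hb h1 h2 => ?_, fun a h b hb h1 h2 => ?_⟩
  · obtain ⟨i, j, rfl, h3, h4⟩ := exists_column_of_mem (hsub h)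
    obtain ⟨i', j', rfl, h5, h6⟩ := exists_column_of_mem hb
    rw [mem_bottomCells (pos_of_le_shorten hs j)] at h
    rw [mem_bottomCells (pos_of_le_shorten hs j')]
    simp only at h1 h2
    subst h1
    have h7 : c j' ≤ c j := hc h2
    have h8 : shorten c s j' ≤ shorten c s j := ha h2
    rw [shorten_of_mem c h.1] at h8
    refine ⟨?_, by omega⟩
    by_contra hj
    rw [shorten_of_notMem c hj] at h8
    omega
  · obtain ⟨i, j, rfl, h3, h4⟩ := exists_column_of_mem (hsub h)
    obtain ⟨i', j', rfl, h5, h6⟩ := exists_column_of_mem hb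
    simp only at h1 h2
    obtain rfl := Fin.ext h1
    rw [mem_bottomCells (pos_of_le_shorten hs j)] at h
    omega

/-- A terminal set of cells is the set of bottom cells of some columns. -/
theorem exists_bottomCells_eq {m : ℕ} {c : Fin m → ℤ} {d : Fin m → ℕ}
    (hcd : ∀ j, (d j : ℤ) ≤ c j)
    (hc : Antitone c) (hd : Antitone d) {E : Finset (ℕ × ℕ)}
    (hE : IsTerminal (columnCells c d) E) :
    ∃ s, (∀ j, (d j : ℤ) ≤ shorten c s j) ∧ Antitone (shorten c s) ∧ bottomCells c s = E := by
  classical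
  obtain ⟨hsub, hrow, hcol⟩ := hE
  have hbot : ∀ i (j : Fin m), (i, (j : ℕ)) ∈ E → d j ≤ i ∧ (i : ℤ) = c j - 1 := by
    intro i j h
    have h1 := mem_columnCells_val.1 (hsub h)
    refine ⟨h1.1, ?_⟩
    by_contra hne
    refine hcol _ h (i + 1, (j : ℕ)) (mem_columnCells_val.2 ⟨by omega, by push_cast; omega⟩) rfl ?_
    exact Nat.lt_succ_self i
  let s : Finset (Fin m) := univ.filter fun j => ∃ i, (i, (j : ℕ)) ∈ E
  have hs : ∀ j, j ∈ s ↔ ∃ i, (i, (j : ℕ)) ∈ E := fun j => by simp [s]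
  have hge : ∀ j, (d j : ℤ) ≤ shorten c s j := by
    intro j
    by_cases hj : j ∈ s
    · obtain ⟨i, hi⟩ := (hs j).1 hj
      have := hbot i j hi
      rw [shorten_of_mem c hj]
      omega
    · rw [shorten_of_notMem c hj]
      exact hcd j
  refine ⟨s, hge, ?_, ?_⟩
  -- If this failed, then `c j = c j'` with only column `j` shortened. Since `d j' ≤ d j`, column
  -- `j'` has a cell in the row of the removed cell, and the row condition puts it in `E`, a
  -- contradiction.
  · intro j j' hjj
    by_contra hlt
    have h1 : c j' ≤ c j := hc hjj
    have h2 := shorten_le c s j'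
    have h3 := sub_one_le_shorten c s j
    have hj : j ∈ s := by
      by_contra hj
      rw [shorten_of_notMem c hj] at hlt
      omega
    have hj' : j' ∉ s := by
      intro hj'
      rw [shorten_of_mem c hj, shorten_of_mem c hj'] at hlt
      omega
    rw [shorten_of_mem c hj, shorten_of_notMem c hj'] at hlt
    obtain ⟨i, hi⟩ := (hs j).1 hj
    have h4 := hbot i j hi
    have h5 : d j' ≤ d j := hd hjj
    exact hj' ((hs j').2 ⟨i, hrow _ hi _ (mem_columnCells_val.2 ⟨by omega, by omega⟩) rfl hjj⟩)
  · ext a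
    constructor
    · intro h
      obtain ⟨j, hj, rfl⟩ := mem_image.1 h
      obtain ⟨i, hi⟩ := (hs j).1 hj
      have := hbot i j hi
      have h1 : (c j - 1).toNat = i := by omega
      rwa [h1]
    · intro h
      obtain ⟨i, j, rfl, h3, h4⟩ := exists_column_of_mem (hsub h)
      rw [mem_bottomCells (pos_of_le_shorten hge j), hs]
      exact ⟨⟨i, h⟩, (hbot i j h).2⟩

-- The recursion of `tableauSum_succ`, reindexed: `bottomCells` is a bijection from the sets of
-- columns whose shortening is again a skew shape to the terminal sets.
open Classical in
theorem tableauSum_columnCells_succ {R : Type*} [CommRing R] {n m : ℕ} (x : Fin (n + 1) → R)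
    {c : Fin m → ℤ} {d : Fin m → ℕ} (hcd : ∀ j, (d j : ℤ) ≤ c j)
    (hc : Antitone c) (hd : Antitone d) :
    tableauSum x (columnCells c d)
      = ∑ s : Finset (Fin m) with (∀ j, (d j : ℤ) ≤ shorten c s j) ∧ Antitone (shorten c s),
        x (Fin.last n) ^ #s *
          tableauSum (fun i => x i.castSucc) (columnCells (shorten c s) d) := by
  rw [tableauSum_succ]
  symm
  refine Finset.sum_bij (fun s _ => bottomCells c s) ?_ ?_ ?_ ?_
  · intro s hs
    have hs := (mem_filter.1 hs).2
    have := isTerminal_bottomCells hc hs.1 hs.2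
    exact mem_filter.2 ⟨mem_powerset.2 this.1, this⟩
  · intro s hs s' hs' h
    have hs := (mem_filter.1 hs).2
    have hs' := (mem_filter.1 hs').2
    ext j
    constructor
    · intro hj
      have h1 : ((c j - 1).toNat, (j : ℕ)) ∈ bottomCells c s :=
        mem_image.2 ⟨j, hj, rfl⟩
      rw [h, mem_bottomCells (pos_of_le_shorten hs'.1 j)] at h1
      exact h1.1
    · intro hj
      have h1 : ((c j - 1).toNat, (j : ℕ)) ∈ bottomCells c s' :=
        mem_image.2 ⟨j, hj, rfl⟩
      rw [← h, mem_bottomCells (pos_of_le_shorten hs.1 j)] at h1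
      exact h1.1
  · intro E hE
    obtain ⟨s, h1, h2, h3⟩ := exists_bottomCells_eq hcd hc hd (mem_filter.1 hE).2
    exact ⟨s, mem_filter.2 ⟨mem_univ _, h1, h2⟩, h3⟩
  · intro s hs
    have hs := (mem_filter.1 hs).2
    rw [card_bottomCells, columnCells_sdiff_bottomCells hs.1]

/-! ### The dual Jacobi–Trudi identity -/

/-- The dual Jacobi–Trudi matrix of the skew shape with column heights `c` and `d`. -/
def jacobiTrudi {R : Type*} [CommRing R] {n m : ℕ} (x : Fin n → R) (c : Fin m → ℤ)
    (d : Fin m → ℕ) : Matrix (Fin m) (Fin m) R :=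
  Matrix.of fun i j => esymmInt x (c i - d j - (i : ℕ) + (j : ℕ))

/-- The recursion for `e_k` writes each row as a sum of two rows; in the second, `c i` drops by one
and the last variable factors out. Multilinearity expands the determinant over the set `s` of rows
where that summand is chosen. -/
theorem det_jacobiTrudi_succ {R : Type*} [CommRing R] {n m : ℕ} (x : Fin (n + 1) → R)
    (c : Fin m → ℤ) (d : Fin m → ℕ) :
    (jacobiTrudi x c d).det = ∑ s : Finset (Fin m), x (Fin.last n) ^ #s *
      (jacobiTrudi (fun i => x i.castSucc) (shorten c s) d).det := by
  classical
  let A : Fin m → Fin m → R := jacobiTrudi (fun i => x i.castSucc) c d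
  let B : Fin m → Fin m → R := fun i j =>
    x (Fin.last n) * jacobiTrudi (fun i => x i.castSucc) (fun i => c i - 1) d i j
  have h1 : (jacobiTrudi x c d : Fin m → Fin m → R) = B + A := by
    funext i j
    simp only [jacobiTrudi, A, B, Matrix.of_apply, esymmInt]
    rw [add_comm]
    congr 3
    ring
  have h2 : (jacobiTrudi x c d).det
      = (Matrix.detRowAlternating (R := R) (n := Fin m)).toMultilinearMap (B + A) := by
    rw [← h1]; rfl
  rw [h2, MultilinearMap.map_add_univ]
  refine Finset.sum_congr rfl fun s _ => ?_
  have h3 : s.piecewise B A = Matrix.of fun i j => (if i ∈ s then x (Fin.last n) else 1) *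
      jacobiTrudi (fun i => x i.castSucc) (shorten c s) d i j := by
    funext i j
    by_cases hi : i ∈ s
    · rw [Finset.piecewise_eq_of_mem s B A hi]
      simp [hi, B, jacobiTrudi, shorten]
    · rw [Finset.piecewise_eq_of_notMem s B A hi]
      simp [hi, A, jacobiTrudi, shorten]
  rw [h3]
  change Matrix.det _ = _
  rw [Matrix.det_mul_column]
  congr 1
  rw [Finset.prod_ite_mem, Finset.univ_inter, Finset.prod_const]

theorem exists_succ_lt_of_not_antitone {m : ℕ} {f : Fin m → ℤ} (h : ¬ Antitone f) :
    ∃ i j : Fin m, (j : ℕ) = i + 1 ∧ f i < f j := by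
  by_contra! hn
  refine h ?_
  rcases m with _ | m
  · exact fun i => i.elim0
  · exact Fin.antitone_iff_succ_le.2 fun i => hn i.castSucc i.succ (by simp)

/-- Shortening can break monotonicity only where two adjacent columns have equal height and the left
one alone is shortened. Then `c i - i` agrees at both indices, so two rows are equal. -/
theorem det_jacobiTrudi_shorten_of_not_antitone {R : Type*} [CommRing R] {n m : ℕ}
    (x : Fin n → R) {c : Fin m → ℤ} (hc : Antitone c) (d : Fin m → ℕ) {s : Finset (Fin m)}
    (hs : ¬ Antitone (shorten c s)) : (jacobiTrudi x (shorten c s) d).det = 0 := by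
  obtain ⟨i, j, hij, hlt⟩ := exists_succ_lt_of_not_antitone hs
  have h1 : c j ≤ c i := hc (Fin.le_def.2 (by omega))
  have h2 := shorten_le c s j
  have h3 := sub_one_le_shorten c s i
  refine Matrix.det_zero_of_row_eq (i := i) (j := j) (fun h => ?_) ?_
  · rw [h] at hij; omega
  · funext k
    simp only [jacobiTrudi, Matrix.of_apply]
    congr 1
    have : ((j : ℕ) : ℤ) = (i : ℕ) + 1 := by exact_mod_cast hij
    omega

/-- Without variables the entries are indicators of `c i - i = d j - j`, with both sides strictly
decreasing in their index. Either some row vanishes, or matching rows to columns is a strictly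
monotone self-map of `Fin m`, hence the identity, and `c = d`. -/
theorem det_jacobiTrudi_zero {R : Type*} [CommRing R] {m : ℕ} (x : Fin 0 → R) {c : Fin m → ℤ}
    {d : Fin m → ℕ} (hc : Antitone c) (hd : Antitone d) :
    (jacobiTrudi x c d).det = if c = fun j => (d j : ℤ) then 1 else 0 := by
  have hcs : StrictAnti fun i : Fin m => c i - (i : ℕ) := fun i j h => by
    have h1 := hc h.le
    have h2 : (i : ℕ) < j := h
    simp only
    omega
  have hds : StrictAnti fun i : Fin m => (d i : ℤ) - (i : ℕ) := fun i j h => by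
    have h1 := hd h.le
    have h2 : (i : ℕ) < j := h
    simp only
    omega
  have hent : ∀ i j, jacobiTrudi x c d i j
      = if c i - (i : ℕ) = (d j : ℤ) - (j : ℕ) then 1 else 0 := by
    intro i j
    simp only [jacobiTrudi, Matrix.of_apply, esymmInt]
    congr 1
    apply propext
    omega
  split_ifs with h
  · have : jacobiTrudi x c d = 1 := by
      ext i j
      rw [hent, Matrix.one_apply, h]
      congr 1
      exact propext ⟨fun h' => hds.injective h', fun h' => by rw [h']⟩
    rw [this, Matrix.det_one]
  · by_cases hr : ∀ i, ∃ j, c i - (i : ℕ) = (d j : ℤ) - (j : ℕ)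
    · exfalso
      apply h
      choose f hf using hr
      have hfm : StrictMono f := by
        intro i j hij
        have := hcs hij
        simp only [hf] at this
        exact hds.lt_iff_gt.1 this
      have hfid : f = id := by
        have hb : Function.Bijective f := Finite.injective_iff_bijective.1 hfm.injective
        have := Subsingleton.elim (hfm.orderIsoOfSurjective f hb.2) (OrderIso.refl (Fin m))
        funext i
        exact DFunLike.congr_fun this i
      funext i
      have := hf i
      rw [hfid] at this
      simp only [id] at this
      omega
    · push Not at hr
      obtain ⟨i, hi⟩ := hr
      exact Matrix.det_eq_zero_of_row_eq_zero i fun j => by rw [hent, if_neg (hi j)]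

open Classical in
/-- The dual Jacobi–Trudi identity. -/
theorem det_jacobiTrudi {R : Type*} [CommRing R] {n m : ℕ} (x : Fin n → R) {c : Fin m → ℤ}
    {d : Fin m → ℕ} (hc : Antitone c) (hd : Antitone d) :
    (jacobiTrudi x c d).det
      = if ∀ j, (d j : ℤ) ≤ c j then tableauSum x (columnCells c d) else 0 := by
  induction n generalizing c with
  | zero =>
    rw [det_jacobiTrudi_zero x hc hd, tableauSum_zero]
    by_cases hcd : ∀ j, (d j : ℤ) ≤ c j
    · rw [if_pos hcd]
      congr 1
      refine propext ⟨fun h => ?_, fun h => ?_⟩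
      · subst h
        refine eq_empty_of_forall_notMem fun a ha => ?_
        obtain ⟨i, j, -, h1, h2⟩ := exists_column_of_mem ha
        omega
      · funext j
        refine le_antisymm ?_ (hcd j)
        by_contra hlt
        have : (d j, (j : ℕ)) ∈ columnCells c d := mem_columnCells_val.2 ⟨le_rfl, by omega⟩
        rw [h] at this
        exact notMem_empty _ this
    · rw [if_neg hcd, if_neg]
      rintro rfl
      exact hcd fun j => le_rfl
  | succ n ih =>
    rw [det_jacobiTrudi_succ]
    have key : ∀ s : Finset (Fin m), x (Fin.last n) ^ #s *
        (jacobiTrudi (fun i => x i.castSucc) (shorten c s) d).det =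
        if (∀ j, (d j : ℤ) ≤ shorten c s j) ∧ Antitone (shorten c s) then
          x (Fin.last n) ^ #s *
            tableauSum (fun i => x i.castSucc) (columnCells (shorten c s) d) else 0 := by
      intro s
      by_cases ha : Antitone (shorten c s)
      · rw [ih _ ha]
        by_cases hge : ∀ j, (d j : ℤ) ≤ shorten c s j
        · rw [if_pos hge, if_pos ⟨hge, ha⟩]
        · rw [if_neg hge, if_neg fun h => hge h.1, mul_zero]
      · rw [det_jacobiTrudi_shorten_of_not_antitone _ hc d ha, if_neg fun h => ha h.2, mul_zero]
    rw [Finset.sum_congr rfl fun s _ => key s, ← Finset.sum_filter]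
    split_ifs with hcd
    · exact (tableauSum_columnCells_succ x hcd hc hd).symm
    · refine Finset.sum_eq_zero fun s hs => ?_
      exact absurd (fun j => ((mem_filter.1 hs).2.1 j).trans (shorten_le c s j)) hcd

/-! ### The transfer matrix -/

/-- The weight of `s` if it is an admissible step, and zero otherwise. -/
def weightOn {F : Type*} [Field F] (S : Finset ℤ) (p q : ℕ → F) (s : ℤ) : F :=
  if s ∈ S then stepWeight p q s else 0

/-- Giving inadmissible steps weight zero removes the step condition from the index set. -/
theorem sum_paths_eq {F : Type*} [Field F] (S : Finset ℤ) (p q : ℕ → F) (w : ℕ)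
    (u v : Fin (w + 1)) (n : ℕ) :
    ∑ h ∈ paths S w u v n, pathWeight p q h
      = ∑ h : Fin (n + 1) → Fin (w + 1), if h 0 = u ∧ h (Fin.last n) = v then
          ∏ i, weightOn S p q (stepOf h i) else 0 := by
  rw [paths, Finset.sum_filter]
  refine Finset.sum_congr rfl fun h _ => ?_
  by_cases hS : ∀ i, stepOf h i ∈ S
  · simp [hS, pathWeight, weightOn]
  · have : ∏ i, weightOn S p q (stepOf h i) = 0 := by
      push Not at hS
      obtain ⟨i, hi⟩ := hS
      exact Finset.prod_eq_zero (mem_univ i) (if_neg hi)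
    simp [hS, this]

theorem sum_paths_zero {F : Type*} [Field F] (S : Finset ℤ) (p q : ℕ → F) (w : ℕ)
    (u v : Fin (w + 1)) :
    ∑ h ∈ paths S w u v 0, pathWeight p q h = if u = v then 1 else 0 := by
  rw [sum_paths_eq, ← (Equiv.funUnique (Fin 1) (Fin (w + 1))).symm.sum_comp]
  simp only [Equiv.funUnique_symm_apply, uniqueElim_const, univ_eq_empty, prod_empty]
  split_ifs with h
  · subst h
    simp
  · refine Finset.sum_eq_zero fun i _ => if_neg ?_
    rintro ⟨rfl, h'⟩
    exact h h'

theorem sum_paths_succ {F : Type*} [Field F] (S : Finset ℤ) (p q : ℕ → F) (w : ℕ)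
    (u v : Fin (w + 1)) (n : ℕ) :
    ∑ h ∈ paths S w u v (n + 1), pathWeight p q h
      = ∑ k : Fin (w + 1), weightOn S p q ((k : ℕ) - (u : ℕ)) *
          ∑ h ∈ paths S w k v n, pathWeight p q h := by
  simp only [sum_paths_eq, Finset.mul_sum]
  rw [Finset.sum_comm, ← (Fin.consEquiv fun _ : Fin (n + 2) => Fin (w + 1)).sum_comp,
    Fintype.sum_prod_type, Finset.sum_comm]
  refine Finset.sum_congr rfl fun g _ => ?_
  have hstep : ∀ a, ∏ i, weightOn S p q (stepOf (Fin.cons a g : Fin (n + 2) → Fin (w + 1)) i)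
      = weightOn S p q ((g 0 : ℕ) - (a : ℕ)) * ∏ i, weightOn S p q (stepOf g i) := by
    intro a
    rw [Fin.prod_univ_succ]
    rfl
  -- With the path split into its first height `a` and the rest `g`, the endpoint conditions leave
  -- only `a = u` on one side and `k = g 0` on the other.
  rw [Finset.sum_eq_single u, Finset.sum_eq_single (g 0)]
  · simp only [Fin.consEquiv_apply, Fin.cons_zero, true_and]
    rw [← Fin.succ_last, Fin.cons_succ]
    split_ifs
    · exact hstep u
    · rw [mul_zero]
  · intro k _ hk
    rw [if_neg fun h => hk h.1.symm, mul_zero]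
  · simp
  · intro a _ ha
    refine if_neg fun h => ha ?_
    simpa using h.1
  · simp

/-- The matrix `1 - t T`, where `T` is the transfer matrix of the slit. -/
noncomputable def kernelMatrix {F : Type*} [Field F] (S : Finset ℤ) (p q : ℕ → F) (w : ℕ) :
    Matrix (Fin (w + 1)) (Fin (w + 1)) (PowerSeries F) :=
  1 - Matrix.of fun i j : Fin (w + 1) =>
    PowerSeries.X * PowerSeries.C (weightOn S p q ((j : ℕ) - (i : ℕ)))

theorem kernelMatrix_mul {F : Type*} [Field F] (S : Finset ℤ) (p q : ℕ → F) (w : ℕ) :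
    kernelMatrix S p q w * Matrix.of (pathGenFun S p q w) = 1 := by
  ext u v n
  rw [kernelMatrix, sub_mul, one_mul, Matrix.sub_apply, Matrix.mul_apply, map_sub, map_sum,
    Matrix.one_apply]
  simp only [Matrix.of_apply, pathGenFun, PowerSeries.coeff_mk, mul_assoc]
  rcases n with _ | n
  · rw [sum_paths_zero]
    simp only [PowerSeries.coeff_zero_X_mul, Finset.sum_const_zero, sub_zero]
    split_ifs <;> simp
  · simp only [PowerSeries.coeff_succ_X_mul, PowerSeries.coeff_C_mul, PowerSeries.coeff_mk]
    rw [sum_paths_succ, sub_self]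
    split_ifs <;> simp [PowerSeries.coeff_one]

/-! ### The coefficients of the kernel -/

theorem natCast_mem_upSteps {S : Finset ℤ} {a : ℕ} : a ∈ upSteps S ↔ (a : ℤ) ∈ S := by
  simp only [upSteps, mem_image, mem_filter]
  constructor
  · rintro ⟨s, ⟨hs, h0⟩, rfl⟩
    rwa [Int.toNat_of_nonneg h0]
  · exact fun h => ⟨a, ⟨h, by omega⟩, by omega⟩

theorem mem_downSteps {S : Finset ℤ} {b : ℕ} : b ∈ downSteps S ↔ 0 < b ∧ -(b : ℤ) ∈ S := by
  simp only [downSteps, mem_image, mem_filter]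
  constructor
  · rintro ⟨s, ⟨hs, h0⟩, rfl⟩
    have : -(((-s).toNat : ℕ) : ℤ) = s := by omega
    rw [this]
    exact ⟨by omega, hs⟩
  · exact fun h => ⟨-b, ⟨h.2, by omega⟩, by omega⟩

theorem weightOn_natCast {F : Type*} [Field F] (S : Finset ℤ) (p q : ℕ → F) (a : ℕ) :
    weightOn S p q a = if a ∈ upSteps S then p a else 0 := by
  simp [weightOn, natCast_mem_upSteps, stepWeight]

theorem weightOn_neg_natCast {F : Type*} [Field F] (S : Finset ℤ) (p q : ℕ → F) {b : ℕ}
    (hb : 0 < b) : weightOn S p q (-(b : ℤ)) = if b ∈ downSteps S then q b else 0 := by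
  have : ¬ (0 : ℤ) ≤ -(b : ℤ) := by omega
  simp only [weightOn, mem_downSteps, stepWeight, hb, true_and, this, if_false, neg_neg,
    Int.toNat_natCast]

theorem coeff_kernelPoly {F : Type*} [Field F] {S : Finset ℤ} (p q : ℕ → F) {β : ℕ}
    (hβ : ∀ b ∈ downSteps S, b ≤ β) (k : ℕ) :
    (kernelPoly S p q β).coeff k
      = (if k = β then 1 else 0) - tVar F * HahnSeries.C (weightOn S p q ((k : ℤ) - β)) := by
  simp only [kernelPoly, Polynomial.coeff_sub, Polynomial.coeff_X_pow, Polynomial.coeff_C_mul,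
    Polynomial.finsetSum_coeff]
  rw [sub_sub, ← mul_add]
  congr 2
  by_cases hk : β ≤ k
  · obtain ⟨a, rfl⟩ := Nat.exists_eq_add_of_le hk
    have h1 : (((β + a : ℕ) : ℤ) - β) = (a : ℕ) := by push_cast; ring
    have h2 : ∀ x ∈ downSteps S, (HahnSeries.C (q x) : LaurentSeries F)
        * (if β + a = β - x then 1 else 0) = 0 := by
      intro x hx
      have := (mem_downSteps.1 hx).1
      have := hβ x hx
      rw [if_neg (by omega), mul_zero]
    rw [h1, weightOn_natCast, Finset.sum_eq_zero h2, add_zero]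
    split_ifs with ha
    · rw [Finset.sum_eq_single a]
      · rw [if_pos (by omega), mul_one]
      · intro x _ hx
        rw [if_neg (by omega), mul_zero]
      · exact fun h => absurd ha h
    · rw [map_zero]
      refine Finset.sum_eq_zero fun x hx => ?_
      have : x ≠ a := fun h => ha (h ▸ hx)
      rw [if_neg (by omega), mul_zero]
  · obtain ⟨b, hb⟩ := Nat.exists_eq_add_of_lt (not_le.1 hk)
    have h1 : ((k : ℤ) - β) = -((b + 1 : ℕ) : ℤ) := by push_cast; omega
    have h2 : ∀ x ∈ upSteps S, (HahnSeries.C (p x) : LaurentSeries F)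
        * (if k = x + β then 1 else 0) = 0 := by
      intro x hx
      rw [if_neg (by omega), mul_zero]
    rw [h1, weightOn_neg_natCast S p q (show 0 < b + 1 by omega), Finset.sum_eq_zero h2, zero_add]
    split_ifs with ha
    · rw [Finset.sum_eq_single (b + 1)]
      · rw [if_pos (by omega), mul_one]
      · intro x hx hne
        have := hβ x hx
        rw [if_neg (by omega), mul_zero]
      · exact fun h => absurd ha h
    · rw [map_zero]
      refine Finset.sum_eq_zero fun x hx => ?_
      have : x ≠ b + 1 := fun h => ha (h ▸ hx)
      have := hβ x hx
      rw [if_neg (by omega), mul_zero]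

theorem tVar_ne_zero (F : Type*) [Field F] : tVar F ≠ 0 := by
  intro h
  have : ((PowerSeries.X : PowerSeries F) : LaurentSeries F)
      = ((0 : PowerSeries F) : LaurentSeries F) := by
    rw [map_zero]; exact h
  exact PowerSeries.X_ne_zero (HahnSeries.ofPowerSeries_injective this)

/-! ### Vieta's formulas for the kernel -/

section Roots

variable {F : Type*} [Field F] {S : Finset ℤ} {α β : ℕ} (p q : ℕ → F)

theorem coeff_kernelPoly_top (hα : IsGreatest (upSteps S : Set ℕ) α) (hα_pos : 0 < α)
    (hβ : ∀ b ∈ downSteps S, b ≤ β) :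
    (kernelPoly S p q β).coeff (α + β) = -(tVar F * HahnSeries.C (p α)) := by
  have h1 : (((α + β : ℕ) : ℤ) - β) = (α : ℕ) := by push_cast; ring
  have h2 : α ∈ upSteps S := hα.1
  rw [coeff_kernelPoly p q hβ, if_neg (by omega), h1, weightOn_natCast, if_pos h2, zero_sub]

theorem natDegree_kernelPoly (hα : IsGreatest (upSteps S : Set ℕ) α) (hα_pos : 0 < α)
    (hβ : ∀ b ∈ downSteps S, b ≤ β) (hp : p α ≠ 0) :
    (kernelPoly S p q β).natDegree = α + β := by
  refine Polynomial.natDegree_eq_of_le_of_coeff_ne_zero ?_ ?_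
  · refine Polynomial.natDegree_le_iff_coeff_eq_zero.2 fun k hk => ?_
    obtain ⟨a, rfl⟩ := Nat.exists_eq_add_of_le (show β ≤ k by omega)
    have h1 : (((β + a : ℕ) : ℤ) - β) = (a : ℕ) := by push_cast; ring
    have h2 : a ∉ upSteps S := fun h => by
      have := hα.2 (Finset.mem_coe.2 h)
      omega
    rw [coeff_kernelPoly p q hβ, if_neg (by omega), h1, weightOn_natCast, if_neg h2, map_zero,
      mul_zero, sub_zero]
  · rw [coeff_kernelPoly_top p q hα hα_pos hβ]
    exact neg_ne_zero.2 (mul_ne_zero (tVar_ne_zero F) (HahnSeries.C_ne_zero hp))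

theorem algebraMap_coeff_kernelPoly (hα : IsGreatest (upSteps S : Set ℕ) α) (hα_pos : 0 < α)
    (hβ : ∀ b ∈ downSteps S, b ≤ β) (hp : p α ≠ 0)
    {L : Type*} [Field L] [Algebra (LaurentSeries F) L] {z : Fin (α + β) → L}
    (hz : univ.val.map z = (kernelPoly S p q β).aroots L) (k : ℕ) :
    algebraMap (LaurentSeries F) L ((kernelPoly S p q β).coeff k)
      = -algebraMap (LaurentSeries F) L (tVar F * HahnSeries.C (p α)) *
        ((-1) ^ (α + β + k) * esymmInt z ((α + β : ℕ) - (k : ℤ))) := by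
  have hdeg := natDegree_kernelPoly p q hα hα_pos hβ hp
  have hlead : (kernelPoly S p q β).leadingCoeff = -(tVar F * HahnSeries.C (p α)) := by
    rw [Polynomial.leadingCoeff, hdeg, coeff_kernelPoly_top p q hα hα_pos hβ]
  -- The family `z` has as many members as the degree, so `hz` already forces the kernel to split
  -- over `L`.
  have hroots : Multiset.card ((kernelPoly S p q β).map (algebraMap (LaurentSeries F) L)).roots
      = ((kernelPoly S p q β).map (algebraMap (LaurentSeries F) L)).natDegree := by
    rw [Polynomial.natDegree_map, hdeg, ← Polynomial.aroots_def, ← hz]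
    simp
  have h := Polynomial.C_leadingCoeff_mul_prod_multiset_X_sub_C hroots
  rw [← Polynomial.aroots_def, ← hz, Polynomial.leadingCoeff_map, hlead, Multiset.map_map] at h
  rw [← Polynomial.coeff_map, ← h, Polynomial.coeff_C_mul, map_neg]
  congr 1
  exact coeff_prod_X_sub_C z k

/-- The entries of `1 - t T` are, up to sign and a constant, elementary symmetric polynomials in
the roots of the kernel. -/
theorem map_kernelMatrix_apply (hα : IsGreatest (upSteps S : Set ℕ) α) (hα_pos : 0 < α)
    (hβ : ∀ b ∈ downSteps S, b ≤ β) (hp : p α ≠ 0)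
    {L : Type*} [Field L] [Algebra (LaurentSeries F) L] {z : Fin (α + β) → L}
    (hz : univ.val.map z = (kernelPoly S p q β).aroots L) {w : ℕ} (i j : Fin (w + 1)) :
    algebraMap (LaurentSeries F) L (kernelMatrix S p q w i j : PowerSeries F)
      = -algebraMap (LaurentSeries F) L (tVar F * HahnSeries.C (p α)) * (-1) ^ α *
        ((-1) ^ (i : ℕ) * ((-1) ^ (j : ℕ) * esymmInt z ((α : ℤ) + (i : ℕ) - (j : ℕ)))) := by
  have hent : ((kernelMatrix S p q w i j : PowerSeries F) : LaurentSeries F)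
      = (if i = j then 1 else 0)
        - tVar F * HahnSeries.C (weightOn S p q ((j : ℕ) - (i : ℕ))) := by
    rw [kernelMatrix, Matrix.sub_apply, Matrix.one_apply, Matrix.of_apply, map_sub, map_mul,
      HahnSeries.ofPowerSeries_C]
    congr 1
    split_ifs <;> simp
  rw [hent]
  by_cases hk : (i : ℕ) ≤ (j : ℕ) + β
  · obtain ⟨k, hk⟩ := Nat.exists_eq_add_of_le hk
    have h1 : ((j : ℕ) : ℤ) - (i : ℕ) = (k : ℤ) - β := by omega
    have h2 : (if i = j then (1 : LaurentSeries F) else 0) = if k = β then 1 else 0 := by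
      congr 1
      exact propext ⟨fun h => by rw [h] at hk; omega, fun h => Fin.ext (by omega)⟩
    rw [h1, h2, ← coeff_kernelPoly p q hβ, algebraMap_coeff_kernelPoly p q hα hα_pos hβ hp hz,
      mul_assoc]
    congr 1
    have h3 : ((α + β : ℕ) : ℤ) - (k : ℤ) = (α : ℤ) + (i : ℕ) - (j : ℕ) := by push_cast; omega
    have h4 : (-1 : L) ^ (α + β + k) = (-1) ^ α * ((-1) ^ (i : ℕ) * (-1) ^ (j : ℕ)) := by
      have h5 : (-1 : L) ^ (i : ℕ) * (-1) ^ (i : ℕ) = 1 := by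
        rw [← mul_pow]; simp
      have h6 : (-1 : L) ^ β * (-1) ^ β = 1 := by
        rw [← mul_pow]; simp
      have h7 : (-1 : L) ^ (j : ℕ) * (-1) ^ β = (-1) ^ (i : ℕ) * (-1) ^ k := by
        rw [← pow_add, hk, pow_add]
      rw [pow_add, pow_add]
      linear_combination ((-1 : L) ^ α * (-1) ^ β * (-1) ^ k) * (-h5)
        - (-1 : L) ^ α * (-1) ^ (i : ℕ) * (-1) ^ β * h7
        + (-1 : L) ^ α * (-1) ^ (i : ℕ) * (-1) ^ (j : ℕ) * h6
    rw [h3, h4]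
    ring
  -- Here the step `j - i` is below `-β`, and the index `α + i - j` exceeds the number of roots, so
  -- both sides vanish.
  · have h1 : (i : ℕ) ≠ j := by omega
    have h2 : weightOn S p q (((j : ℕ) : ℤ) - (i : ℕ)) = 0 := by
      have h3 : ((j : ℕ) : ℤ) - (i : ℕ) = -(((i : ℕ) - (j : ℕ) : ℕ) : ℤ) := by omega
      rw [h3, weightOn_neg_natCast S p q (by omega), if_neg]
      intro h
      have := hβ _ h
      omega
    rw [h2, if_neg fun h => h1 (congrArg _ h),
      esymmInt_eq_zero_of_lt z (by push_cast; omega)]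
    simp

end Roots

/-! ### The shapes -/

theorem aeval_skewSchur {R : Type*} [CommRing R] {n : ℕ} (z : Fin n → R) {lam mu : YoungDiagram}
    (h : mu ≤ lam) :
    MvPolynomial.aeval z (skewSchur n lam mu) = tableauSum z (lam.cells \ mu.cells) := by
  rw [skewSchur, if_pos h, map_sum, tableauSum]
  refine Finset.sum_congr rfl fun T _ => ?_
  simp [map_prod]

theorem mem_rectShape {α β m i j : ℕ} : (i, j) ∈ rectShape α β m ↔ i < α ∧ j < m := by
  rw [rectShape, YoungDiagram.mem_ofRowLens]
  simp only [List.length_append, List.length_replicate, List.getElem_append,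
    List.getElem_replicate]
  constructor
  · rintro ⟨h, h'⟩
    split_ifs at h' with h1
    · exact ⟨h1, h'⟩
    · omega
  · rintro ⟨h1, h2⟩
    refine ⟨by omega, ?_⟩
    rwa [dif_pos h1]

theorem mem_innerShape {α β v i j : ℕ} : (i, j) ∈ innerShape α β v ↔ i = 0 ∧ j < v := by
  rw [innerShape, YoungDiagram.mem_ofRowLens]
  rcases i with _ | i <;> simp

theorem mem_outerShape {α β w : ℕ} {u : Fin (w + 1)} {i j : ℕ} :
    (i, j) ∈ outerShape α β w u ↔ i < α ∧ j < w ∨ i = α ∧ j < u := by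
  rw [outerShape, YoungDiagram.mem_ofRowLens]
  simp only [List.length_append, List.length_replicate, List.getElem_append,
    List.getElem_replicate, List.length_cons]
  constructor
  · rintro ⟨h, h'⟩
    split_ifs at h' with h1
    · exact Or.inl ⟨h1, h'⟩
    · rw [List.getElem_cons] at h'
      split_ifs at h' with h2
      · exact Or.inr ⟨by omega, h'⟩
      · simp at h'
  · rintro (⟨h1, h2⟩ | ⟨rfl, h2⟩)
    · refine ⟨by omega, ?_⟩
      rwa [dif_pos h1]
    · refine ⟨by omega, ?_⟩
      simpa using h2

theorem innerShape_le_outerShape {α β w : ℕ} (hα : 0 < α) (u v : Fin (w + 1)) :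
    innerShape α β v ≤ outerShape α β w u := by
  rintro ⟨i, j⟩ h
  obtain ⟨rfl, h⟩ := mem_innerShape.1 h
  exact mem_outerShape.2 (Or.inl ⟨hα, by omega⟩)

theorem rectShape_cells (α β m : ℕ) :
    (rectShape α β m).cells \ (⊥ : YoungDiagram).cells
      = columnCells (fun _ : Fin m => (α : ℤ)) (fun _ => 0) := by
  ext ⟨i, j⟩
  rw [mem_columnCells, mem_sdiff, YoungDiagram.mem_cells, mem_rectShape]
  simp only [YoungDiagram.cells_bot, notMem_empty, not_false_eq_true, and_true, zero_le, true_and,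
    Nat.cast_lt, exists_prop]
  exact and_comm

/-- The column heights of the shape `(w^α, u)`. -/
def outerHeight (α : ℕ) {w : ℕ} (u : Fin (w + 1)) (j : Fin w) : ℤ :=
  if j.castSucc < u then α + 1 else α

/-- The column heights of the shape `(v)`. -/
def innerHeight {w : ℕ} (v : Fin (w + 1)) (j : Fin w) : ℕ :=
  if j.castSucc < v then 1 else 0

theorem antitone_outerHeight (α : ℕ) {w : ℕ} (u : Fin (w + 1)) : Antitone (outerHeight α u) := by
  intro i j h
  simp only [outerHeight, Fin.lt_def, Fin.val_castSucc]
  have := Fin.le_def.1 h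
  split_ifs <;> omega

theorem antitone_innerHeight {w : ℕ} (v : Fin (w + 1)) : Antitone (innerHeight v) := by
  intro i j h
  simp only [innerHeight, Fin.lt_def, Fin.val_castSucc]
  have := Fin.le_def.1 h
  split_ifs <;> omega

theorem innerHeight_le_outerHeight {α w : ℕ} (hα : 0 < α) (u v : Fin (w + 1)) (j : Fin w) :
    (innerHeight v j : ℤ) ≤ outerHeight α u j := by
  simp only [innerHeight, outerHeight]
  split_ifs <;> push_cast <;> omega

theorem outerShape_cells_sdiff {α w : ℕ} (β : ℕ) (u v : Fin (w + 1)) :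
    (outerShape α β w u).cells \ (innerShape α β v).cells
      = columnCells (outerHeight α u) (innerHeight v) := by
  ext ⟨i, j⟩
  rw [mem_columnCells, mem_sdiff, YoungDiagram.mem_cells, YoungDiagram.mem_cells, mem_outerShape,
    mem_innerShape]
  simp only [outerHeight, innerHeight, Fin.lt_def, Fin.val_castSucc]
  constructor
  · rintro ⟨h1, h2⟩
    refine ⟨by omega, ?_, ?_⟩ <;> split_ifs <;> omega
  · rintro ⟨h1, h2, h3⟩
    split_ifs at h2 h3 <;> omega

/-! ### The determinant and the cofactors of `1 - t T` -/

/-- The Toeplitz matrix with entries `e_{α + i - j}`. -/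
def esymmToeplitz {R : Type*} [CommRing R] {n : ℕ} (z : Fin n → R) (α w : ℕ) :
    Matrix (Fin (w + 1)) (Fin (w + 1)) R :=
  Matrix.of fun i j => esymmInt z ((α : ℤ) + (i : ℕ) - (j : ℕ))

theorem det_esymmToeplitz {R : Type*} [CommRing R] {n : ℕ} (z : Fin n → R) (α β w : ℕ) :
    (esymmToeplitz z α w).det
      = MvPolynomial.aeval z (schur n (rectShape α β (w + 1))) := by
  rw [schur, aeval_skewSchur z bot_le, rectShape_cells, ← Matrix.det_transpose]
  have h := det_jacobiTrudi z (c := fun _ : Fin (w + 1) => (α : ℤ)) (d := fun _ => 0)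
    antitone_const antitone_const
  rw [if_pos fun _ => by positivity] at h
  rw [← h]
  congr 1
  ext i j
  simp only [esymmToeplitz, jacobiTrudi, Matrix.transpose_apply, Matrix.of_apply]
  congr 1
  push_cast
  ring

theorem val_succAbove {w : ℕ} (u : Fin (w + 1)) (j : Fin w) :
    (u.succAbove j : ℕ) = if j.castSucc < u then (j : ℕ) else j + 1 := by
  rw [Fin.succAbove]
  split_ifs <;> simp

/-- Deleting an index shifts the later ones by one. After transposition, skipping `u` and `v`
changes the Toeplitz index by `-[i ≥ u] + [j ≥ v] = [i < u] - [j < v]`, which is the contribution of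
the row `u` to the outer column heights and of the row `v` to the inner ones. -/
theorem det_esymmToeplitz_submatrix {R : Type*} [CommRing R] {n : ℕ} (z : Fin n → R) {α : ℕ}
    (hα : 0 < α) (β w : ℕ) (u v : Fin (w + 1)) :
    ((esymmToeplitz z α w).submatrix v.succAbove u.succAbove).det
      = MvPolynomial.aeval z (skewSchur n (outerShape α β w u) (innerShape α β v)) := by
  rw [aeval_skewSchur z (innerShape_le_outerShape hα u v), outerShape_cells_sdiff,
    ← Matrix.det_transpose]
  have h := det_jacobiTrudi z (antitone_outerHeight α u) (antitone_innerHeight v)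
  rw [if_pos (innerHeight_le_outerHeight hα u v)] at h
  rw [← h]
  congr 1
  ext i j
  simp only [esymmToeplitz, jacobiTrudi, Matrix.transpose_apply, Matrix.of_apply,
    Matrix.submatrix_apply, val_succAbove, outerHeight, innerHeight]
  congr 1
  split_ifs <;> push_cast <;> ring

/-- Scale a matrix by `κ` and the sign `(-1) ^ (i + j)`. -/
def signScale {R : Type*} [CommRing R] {k : ℕ} (κ : R) (E : Matrix (Fin k) (Fin k) R) :
    Matrix (Fin k) (Fin k) R :=
  Matrix.of fun i j => κ * ((-1) ^ (i : ℕ) * ((-1) ^ (j : ℕ) * E i j))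

theorem det_signScale_submatrix {R : Type*} [CommRing R] {m k : ℕ} (κ : R) (E : Matrix (Fin k) (Fin k) R)
    (f g : Fin m → Fin k) :
    ((signScale κ E).submatrix f g).det
      = κ ^ m * ((∏ i, (-1) ^ (f i : ℕ)) * ((∏ j, (-1) ^ (g j : ℕ)) *
        (E.submatrix f g).det)) := by
  have h : (signScale κ E).submatrix f g
      = κ • Matrix.of fun i j => (-1) ^ (f i : ℕ) *
        (Matrix.of fun i j => (-1) ^ (g j : ℕ) * E.submatrix f g i j) i j := by
    ext i j
    simp [signScale]
  rw [h, Matrix.det_smul, Matrix.det_mul_column, Matrix.det_mul_row, Fintype.card_fin]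

theorem prod_neg_one_pow_sq {R : Type*} [CommRing R] (m : ℕ) :
    (∏ i : Fin m, (-1 : R) ^ (i : ℕ)) * ∏ i : Fin m, (-1 : R) ^ (i : ℕ) = 1 := by
  rw [← Finset.prod_mul_distrib]
  exact Finset.prod_eq_one fun i _ => by rw [← mul_pow]; simp

theorem det_signScale {R : Type*} [CommRing R] {k : ℕ} (κ : R)
    (E : Matrix (Fin k) (Fin k) R) :
    (signScale κ E).det
      = κ ^ k * E.det := by
  have h := det_signScale_submatrix κ E id id
  simp only [Matrix.submatrix_id_id, id] at h
  rw [h, ← mul_assoc (∏ i : Fin k, (-1 : R) ^ (i : ℕ)), prod_neg_one_pow_sq, one_mul]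

/-- The cofactor sign `(-1)^(u+v)` supplies the factors missing from the two sign products over the
remaining rows and columns; the completed products are equal and multiply to `1`. -/
theorem adjugate_signScale {R : Type*} [CommRing R] {w : ℕ} (κ : R)
    (E : Matrix (Fin (w + 1)) (Fin (w + 1)) R) (u v : Fin (w + 1)) :
    (signScale κ E).adjugate u v
      = κ ^ w * (E.submatrix v.succAbove u.succAbove).det := by
  rw [Matrix.adjugate_fin_succ_eq_det_submatrix, det_signScale_submatrix]
  have h1 := Fin.prod_univ_succAbove (fun i : Fin (w + 1) => (-1 : R) ^ (i : ℕ)) u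
  have h2 := Fin.prod_univ_succAbove (fun i : Fin (w + 1) => (-1 : R) ^ (i : ℕ)) v
  have h3 := prod_neg_one_pow_sq (R := R) (w + 1)
  nth_rewrite 1 [h1] at h3
  rw [h2] at h3
  rw [pow_add]
  linear_combination (κ ^ w * (E.submatrix v.succAbove u.succAbove).det) * h3

end SlitPaths

theorem theorem1 {F : Type*} [Field F]
    -- the step set, the maxima of its up and down steps, and the step weights
    (S : Finset ℤ) (α β : ℕ)
    (hα : IsGreatest (SlitPaths.upSteps S : Set ℕ) α) (hα_pos : 0 < α)
    (hβ : IsGreatest (SlitPaths.downSteps S : Set ℕ) β)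
    (p q : ℕ → F) (hp : p α ≠ 0) (hq : q β ≠ 0)
    -- the width of the slit, the starting height and the final height
    (w : ℕ) (u v : Fin (w + 1))
    -- the roots of the kernel, with multiplicities, in an extension field of `F((t))`
    {L : Type*} [Field L] [Algebra (LaurentSeries F) L]
    (z : Fin (α + β) → L)
    (hz : Finset.univ.val.map z = (SlitPaths.kernelPoly S p q β).aroots L) :
    MvPolynomial.aeval z (SlitPaths.schur (α + β) (SlitPaths.rectShape α β (w + 1))) ≠ 0 ∧
    algebraMap (LaurentSeries F) L (SlitPaths.pathGenFun S p q w u v : LaurentSeries F) =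
      (-1 : L) ^ (1 - (α : ℤ)) /
          algebraMap (LaurentSeries F) L (SlitPaths.tVar F * HahnSeries.C (p α)) *
        (MvPolynomial.aeval z (SlitPaths.skewSchur (α + β)
            (SlitPaths.outerShape α β w u) (SlitPaths.innerShape α β v)) /
          MvPolynomial.aeval z (SlitPaths.schur (α + β)
            (SlitPaths.rectShape α β (w + 1)))) := by
  have hβ' : ∀ b ∈ SlitPaths.downSteps S, b ≤ β := fun b hb => hβ.2 (Finset.mem_coe.2 hb)
  let φ : PowerSeries F →+* L :=
    (algebraMap (LaurentSeries F) L).comp (HahnSeries.ofPowerSeries ℤ F)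
  set c := algebraMap (LaurentSeries F) L (SlitPaths.tVar F * HahnSeries.C (p α)) with hc
  have hc0 : c ≠ 0 := (map_ne_zero _).2
    (mul_ne_zero (SlitPaths.tVar_ne_zero F) (HahnSeries.C_ne_zero hp))
  let κ : L := -c * (-1) ^ α
  have hκ : κ ≠ 0 := mul_ne_zero (neg_ne_zero.2 hc0) (pow_ne_zero _ (by simp))
  let E := SlitPaths.esymmToeplitz z α w
  have hM : (SlitPaths.kernelMatrix S p q w).map φ
      = SlitPaths.signScale κ E := by
    ext i j
    exact SlitPaths.map_kernelMatrix_apply p q hα hα_pos hβ' hp hz i j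
  have hMG : (SlitPaths.kernelMatrix S p q w).map φ
      * (Matrix.of (SlitPaths.pathGenFun S p q w)).map φ = 1 := by
    rw [← Matrix.map_mul, SlitPaths.kernelMatrix_mul]
    exact Matrix.map_one _ (map_zero φ) (map_one φ)
  -- Invertibility of `1 - tT` is the source of the nonvanishing claim, as this determinant is `κ ^
  -- (w + 1)` times the rectangular Schur function.
  have hdet : ((SlitPaths.kernelMatrix S p q w).map φ).det ≠ 0 := fun h => by
    have := congrArg Matrix.det hMG
    rw [Matrix.det_mul, h, zero_mul, Matrix.det_one] at this
    exact zero_ne_one this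
  have hadj : ((SlitPaths.kernelMatrix S p q w).map φ).det
      • (Matrix.of (SlitPaths.pathGenFun S p q w)).map φ
        = ((SlitPaths.kernelMatrix S p q w).map φ).adjugate := by
    have h := congrArg (((SlitPaths.kernelMatrix S p q w).map φ).adjugate * ·) hMG
    simpa only [← mul_assoc, Matrix.adjugate_mul, Matrix.smul_mul, one_mul, mul_one] using h
  have huv := congrFun (congrFun hadj u) v
  rw [hM, SlitPaths.det_signScale, SlitPaths.det_esymmToeplitz z α β w] at hdet
  rw [hM, SlitPaths.det_signScale, SlitPaths.adjugate_signScale,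
    SlitPaths.det_esymmToeplitz z α β w,
    SlitPaths.det_esymmToeplitz_submatrix z hα_pos β w u v] at huv
  have hs := right_ne_zero_of_mul hdet
  refine ⟨hs, ?_⟩
  have huv' : κ ^ (w + 1) * MvPolynomial.aeval z
        (SlitPaths.schur (α + β) (SlitPaths.rectShape α β (w + 1)))
      * algebraMap (LaurentSeries F) L (SlitPaths.pathGenFun S p q w u v : LaurentSeries F)
      = κ ^ w * MvPolynomial.aeval z (SlitPaths.skewSchur (α + β)
            (SlitPaths.outerShape α β w u) (SlitPaths.innerShape α β v)) := huv
  -- The determinant carries `κ ^ (w + 1)` and the cofactor `κ ^ w`; the single surviving `κ⁻¹` is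
  -- the prefactor of the formula.
  have hsign : (-1 : L) ^ (1 - (α : ℤ)) / c = κ⁻¹ := by
    have h1 : (-1 : L) ^ α * (-1) ^ α = 1 := by rw [← mul_pow]; simp
    have h2 : (-1 : L) ^ α ≠ 0 := pow_ne_zero _ (by simp)
    rw [zpow_sub₀ (by simp), zpow_one, zpow_natCast]
    simp only [κ]
    field_simp
  rw [hsign]
  refine mul_left_cancel₀ hdet ?_
  rw [huv', pow_succ]
  field_simp
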